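/- Let $k$ be a field and $\mathcal D=\{D_j\mid j\in J\}$ an arbitrary family of operation symbols. An associative differential algebra (or $\mathcal D$-algebra) is a unital associative $k$-algebra $A$ with $k$-linear maps $D_j\colon A\to A$ ($j\in J$) such that $D_j(xy)=D_j(x)y+xD_j(y)$ for all $x,y\in A$. It is generated by a subset $s$ if no proper unital subalgebra containing $s$ is closed under all $D_j$. An embedding is an injective unital algebra homomorphism that commutes with all $D_j$. **Theorem.** Every countably generated associative differential algebra can be embedded into an associative differential algebra (with the same $\mathcal D$) generated by two elements. More precisely, let $X=\{x_i\mid i\in I\}$ be a set of letters with pairwise distinct indices, $I\subseteq\{1,2,\dots\}$, let $k\langle X;\mathcal D\rangle$ be the free differential algebra on $X$ (the free unital associative algebra on the symbols $D_{j_1}\cdots D_{j_m}(x)$, $x\in X$, $m\ge 0$, with the evident operations $D_j$), let $S\subseteq k\langle X;\mathcal D\rangle$ be any subset, and let $k\langle X;\mathcal D\mid S\rangle$ be the quotient by the two-sided ideal closed under all $D_j$ that is generated by $S$. Let $a,b$ be two new letters. Then there is an embedding of differential algebras $$k\langle X;\mathcal D\mid S\rangle\;\to\;k\langle X,a,b;\mathcal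 D\mid S,\ aab^{i}ab=x_i\ (i\in I)\rangle ,\qquad x_i\mapsto x_i ,$$ and the differential algebra on the right is generated by $\{a,b\}$. -/

import Mathlib

/-- A unital associative `k`-algebra `A` with a family `(D_j)_{j ∈ J}` of `k`-linear operations,
each satisfying the Leibniz rule. No relation between different operations is imposed. -/
class DifferentialOps (k : Type*) (J : Type*) (A : Type*) [CommRing k] [Ring A] [Algebra k A] where
  /-- the operation `D_j` -/
  der : J → A →ₗ[k] A
  /-- the Leibniz rule -/
  leibniz : ∀ (j : J) (x y : A), der j (x * y) = der j x * y + x * der j y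

namespace DifferentialOps

section General

variable (k : Type*) {J : Type*} {A : Type*} [CommRing k] [Ring A] [Algebra k A]
  [DifferentialOps k J A]

/-- The operation `D_j` of a differential algebra, with the base field explicit. -/
abbrev D (j : J) : A →ₗ[k] A := der j

variable (J)

/-- The differential subalgebra generated by `s`: the smallest unital subalgebra that contains `s`
and is closed under all operations `D_j`. -/
def adjoin (s : Set A) : Subalgebra k A :=
  sInf {T : Subalgebra k A | s ⊆ T ∧ ∀ (j : J), ∀ x ∈ T, D k j x ∈ T}

variable (A) in
/-- `A` is generated by a countable set as a differential algebra. -/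
def CountablyGenerated : Prop :=
  ∃ s : Set A, s.Countable ∧ adjoin k J s = ⊤

/-- The differential ideal generated by `S`: the smallest two-sided ideal that contains `S`
and is closed under all operations `D_j`. -/
def ideal (S : Set A) : TwoSidedIdeal A :=
  sInf {I : TwoSidedIdeal A | S ⊆ I ∧ ∀ (j : J), ∀ x ∈ I, D k j x ∈ I}

theorem D_mem_ideal (S : Set A) (j : J) {x : A} (hx : x ∈ ideal k J S) :
    D k j x ∈ ideal k J S := by
  rw [ideal, TwoSidedIdeal.mem_sInf] at hx ⊢
  exact fun I hI => hI.2 j x (hx I hI)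

/-- The quotient of a differential algebra by the differential ideal generated by `S`. -/
abbrev DQuot (S : Set A) : Type _ := (ideal k J S).ringCon.Quotient

/-- The class of an element in the quotient. -/
abbrev DQuot.mk (S : Set A) (x : A) : DQuot k J S := (x : (ideal k J S).ringCon.Quotient)

/-- The operations on the quotient: `D_j` of the class of `x` is the class of `D_j x`. -/
instance (S : Set A) : DifferentialOps k J (DQuot k J S) where
  der j :=
    { toFun := fun q => Quotient.liftOn' q (fun x => DQuot.mk k J S (D k j x)) (by
        intro x y h
        refine (RingCon.eq _).2 ?_
        have h' : (ideal k J S).ringCon x y := h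
        rw [TwoSidedIdeal.rel_iff] at h' ⊢
        rw [← map_sub]
        exact D_mem_ideal k J S j h')
      map_add' := by
        intro p q
        induction p using Quotient.inductionOn'
        induction q using Quotient.inductionOn'
        rename_i x y
        exact congrArg (DQuot.mk k J S) (map_add (D k j) x y)
      map_smul' := by
        intro c p
        induction p using Quotient.inductionOn'
        rename_i x
        exact congrArg (DQuot.mk k J S) (map_smul (D k j) c x) }
  leibniz j p q := by
    induction p using Quotient.inductionOn'
    induction q using Quotient.inductionOn'
    rename_i x y
    exact congrArg (DQuot.mk k J S) (leibniz (k := k) j x y)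

theorem D_mk (S : Set A) (j : J) (x : A) :
    D k j (DQuot.mk k J S x) = DQuot.mk k J S (D k j x) := rfl

end General

section Free

variable (k : Type*) (J : Type*) (X : Type*) [CommRing k]

/-- The free differential algebra `k⟨X; D⟩`: the free associative algebra on the symbols
`D_{j₁} ⋯ D_{jₘ}(x)`, here the pairs `(x, [j₁, …, jₘ])`. -/
abbrev Free : Type _ := FreeAlgebra k (X × List J)

variable {X}

/-- The generator `x` of the free differential algebra. -/
def Free.of (x : X) : Free k J X := FreeAlgebra.ι k (x, [])

variable {J}

/-- The algebra homomorphism `u ↦ (u, D_j u)` to the square-zero extension, determined by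
`D_{i₁} ⋯ D_{iₘ}(x) ↦ D_j D_{i₁} ⋯ D_{iₘ}(x)`. -/
def Free.derHom (j : J) : Free k J X →ₐ[k] TrivSqZeroExt (Free k J X) (Free k J X) :=
  FreeAlgebra.lift k fun p =>
    TrivSqZeroExt.inl (FreeAlgebra.ι k p) + TrivSqZeroExt.inr (FreeAlgebra.ι k (p.1, j :: p.2))

theorem Free.fst_derHom (j : J) (u : Free k J X) : (Free.derHom k j u).fst = u := by
  have h : (TrivSqZeroExt.fstHom k (Free k J X) (Free k J X)).comp (Free.derHom k j) =
      AlgHom.id k (Free k J X) := by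
    ext p
    simp [Free.derHom]
  exact DFunLike.congr_fun h u

/-- The operations of the free differential algebra. -/
instance : DifferentialOps k J (Free k J X) where
  der j :=
    { toFun := fun u => (Free.derHom k j u).snd
      map_add' := by simp
      map_smul' := by simp }
  leibniz j x y := by
    simp [Free.fst_derHom, add_comm]

theorem Free.D_ι (j : J) (p : X × List J) :
    D k j (FreeAlgebra.ι k p : Free k J X) = FreeAlgebra.ι k (p.1, j :: p.2) := by
  simp [D, der, Free.derHom]

variable (J)

/-- The differential algebra `k⟨X; D | S⟩` with generators `X` and relations `S`. -/
abbrev Presented (S : Set (Free k J X)) : Type _ := DQuot k J S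

/-- The generator `x` of `k⟨X; D | S⟩`. -/
def Presented.of (S : Set (Free k J X)) (x : X) : Presented k J S :=
  DQuot.mk k J S (Free.of k J x)

/-- The inclusion `k⟨X; D⟩ → k⟨X, a, b; D⟩`, the two new letters being
`a = Sum.inr 0` and `b = Sum.inr 1`. -/
def Free.incl : Free k J X →ₐ[k] Free k J (X ⊕ Fin 2) :=
  FreeAlgebra.lift k fun p => FreeAlgebra.ι k (Sum.inl p.1, p.2)

/-- The relations `S` together with `a a bⁱ a b = x` for each `x : X`, where `i = e x` is the
index of `x`. -/
def extendedRelations (e : X → ℕ) (S : Set (Free k J X)) : Set (Free k J (X ⊕ Fin 2)) :=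
  let a : Free k J (X ⊕ Fin 2) := Free.of k J (Sum.inr 0)
  let b : Free k J (X ⊕ Fin 2) := Free.of k J (Sum.inr 1)
  Free.incl k J '' S ∪
    Set.range fun x : X => a * a * b ^ e x * a * b - Free.of k J (Sum.inl x)

end Free

end DifferentialOps

universe u v w z

open DifferentialOps

/-!
The generation statement is a direct check, and the embedding follows from the universal property
of a presentation once a single model is found: for a differential algebra `A` and a sequence
`y : ℕ → A`, a differential algebra `B` containing `A` and elements `a b : B` with
`a a bⁱ a b = y i` for all `i ≥ 1`.

The model is `B = End_k(M)`, where `M` is the free right `A`-module on the set `List ℕ × ℕ`.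
If `D_j` also denotes its coordinatewise action on `M`, the commutator `T ↦ D_j T - T D_j` is a
derivation of `B`, and the left multiplications `L_x` satisfy `D_j L_x - L_x D_j = L_{D_j x}`, so
that `A` embeds into `B` as a differential algebra. No condition ties the operations to `a` and `b`,
so `a` and `b` may be arbitrary linear maps. The set `List ℕ × ℕ` carries two injections with
disjoint images, `β (l, n) = (l, n + 1)` and `γ (l, n) = (n :: l, 0)`. Let `b` act by `β` on the
basis, and let `a` send `β e` to `γ e`, and `γ (βⁱ⁻¹ (γ e))` to `e · y i`. Then
`e ↦ β e ↦ γ e ↦ βⁱ (γ e) ↦ γ (βⁱ⁻¹ (γ e)) ↦ e · y i` under the successive factors of `a a bⁱ a b`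
(`operator_word`).

For the first half of the theorem, a countably generated `A` is presented on the letters `ℕ` with
all its relations; this also places the two-generated algebra in the required universe.
-/

namespace DifferentialOps

/-! ### Differential homomorphisms out of free and presented algebras -/

section Universal

variable {k : Type*} {J : Type*} [CommRing k]
variable {A : Type*} [Ring A] [Algebra k A] [DifferentialOps k J A]
variable {B : Type*} [Ring B] [Algebra k B] [DifferentialOps k J B]
variable {X : Type*}

theorem D_one (j : J) : D k j (1 : A) = 0 := by
  have h := leibniz (k := k) j (1 : A) 1
  rw [mul_one, mul_one, one_mul] at h
  exact left_eq_add.mp h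

theorem D_algebraMap (j : J) (r : k) : D k j (algebraMap k A r) = 0 := by
  rw [Algebra.algebraMap_eq_smul_one, map_smul, D_one, smul_zero]

theorem Free.map_D_of_map_D_ι (f : Free k J X →ₐ[k] B)
    (h : ∀ (j : J) (p : X × List J),
      f (FreeAlgebra.ι k (p.1, j :: p.2)) = D k j (f (FreeAlgebra.ι k p)))
    (j : J) (u : Free k J X) : f (D k j u) = D k j (f u) := by
  induction u using FreeAlgebra.induction with
  | grade0 r => rw [D_algebraMap, map_zero, AlgHom.commutes, D_algebraMap]
  | grade1 p => rw [Free.D_ι, h]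
  | mul u v hu hv =>
    have h1 := leibniz (k := k) j u v
    have h2 := leibniz (k := k) j (f u) (f v)
    simp only [D] at hu hv ⊢
    rw [h1, map_add, map_mul, map_mul, map_mul, h2, hu, hv]
  | add u v hu hv => simp only [map_add, hu, hv]

/-- The differential homomorphism from the free differential algebra given by the images of the
letters. -/
def Free.lift (f : X → B) : Free k J X →ₐ[k] B :=
  FreeAlgebra.lift k fun p => p.2.foldr (fun j u => D k j u) (f p.1)

theorem Free.lift_of (f : X → B) (x : X) : Free.lift f (Free.of k J x) = f x := by
  simp [Free.lift, Free.of]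

theorem Free.lift_D (f : X → B) (j : J) (u : Free k J X) :
    Free.lift f (D k j u) = D k j (Free.lift f u) :=
  Free.map_D_of_map_D_ι _ (fun j p => by simp [Free.lift]) j u

theorem Free.incl_of (x : X) : Free.incl k J (Free.of k J x) = Free.of k J (Sum.inl x) := by
  simp [Free.incl, Free.of]

theorem Free.incl_D (j : J) (u : Free k J X) :
    Free.incl k J (D k j u) = D k j (Free.incl k J u) :=
  Free.map_D_of_map_D_ι _ (fun j p => by simp [Free.incl, Free.D_ι]) j u

theorem Free.eq_top_of_of_mem (T : Subalgebra k (Free k J X)) (hof : ∀ x, Free.of k J x ∈ T)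
    (hD : ∀ (j : J), ∀ u ∈ T, D k j u ∈ T) : T = ⊤ := by
  rw [eq_top_iff, ← FreeAlgebra.adjoin_range_ι, Algebra.adjoin_le_iff]
  rintro _ ⟨⟨x, l⟩, rfl⟩
  induction l with
  | nil => exact hof x
  | cons j l ih =>
    have h := hD j _ ih
    rwa [Free.D_ι] at h

theorem Free.hom_ext {f g : Free k J X →ₐ[k] B}
    (hf : ∀ (j : J) u, f (D k j u) = D k j (f u)) (hg : ∀ (j : J) u, g (D k j u) = D k j (g u))
    (h : ∀ x, f (Free.of k J x) = g (Free.of k J x)) : f = g := by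
  have hT := Free.eq_top_of_of_mem (AlgHom.equalizer f g) h fun j u hu => by
    rw [AlgHom.mem_equalizer] at hu ⊢
    rw [hf, hg, hu]
  ext u
  have : FreeAlgebra.ι k u ∈ AlgHom.equalizer f g := hT ▸ Algebra.mem_top
  exact this

theorem map_eq_zero_of_mem_ideal (f : A →ₐ[k] B) (hf : ∀ (j : J) x, f (D k j x) = D k j (f x))
    {S : Set A} (hS : ∀ s ∈ S, f s = 0) {x : A} (hx : x ∈ ideal k J S) : f x = 0 := by
  rw [ideal, TwoSidedIdeal.mem_sInf] at hx
  refine (TwoSidedIdeal.mem_ker f).1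
    (hx (I := TwoSidedIdeal.ker f) ⟨fun s hs => ?_, fun j x hx => ?_⟩)
  · exact (TwoSidedIdeal.mem_ker f).2 (hS s hs)
  · rw [TwoSidedIdeal.mem_ker] at hx ⊢
    rw [hf, hx, map_zero]

theorem subset_ideal (S : Set A) : S ⊆ ideal k J S := fun s hs => by
  rw [SetLike.mem_coe, ideal, TwoSidedIdeal.mem_sInf]
  exact fun I hI => hI.1 hs

theorem DQuot.mk_eq_zero {S : Set A} {x : A} :
    DQuot.mk k J S x = 0 ↔ x ∈ ideal k J S := by
  rw [TwoSidedIdeal.mem_iff]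
  exact RingCon.eq _

/-- The homomorphism induced on the quotient by the differential ideal generated by `S`. -/
def DQuot.lift {S : Set A} (f : A →ₐ[k] B) (hf : ∀ (j : J) x, f (D k j x) = D k j (f x))
    (hS : ∀ s ∈ S, f s = 0) : DQuot k J S →ₐ[k] B :=
  RingCon.liftₐ _ f fun x y h => by
    rw [TwoSidedIdeal.rel_iff] at h
    have := map_eq_zero_of_mem_ideal f hf hS h
    rw [map_sub, sub_eq_zero] at this
    exact this

theorem DQuot.lift_mk {S : Set A} (f : A →ₐ[k] B) (hf : ∀ (j : J) x, f (D k j x) = D k j (f x))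
    (hS : ∀ s ∈ S, f s = 0) (x : A) : DQuot.lift f hf hS (DQuot.mk k J S x) = f x :=
  rfl

theorem DQuot.mk_surjective (S : Set A) : Function.Surjective (DQuot.mk k J S) :=
  RingCon.mkₐ_surjective (α := k) _

theorem DQuot.lift_D {S : Set A} (f : A →ₐ[k] B) (hf : ∀ (j : J) x, f (D k j x) = D k j (f x))
    (hS : ∀ s ∈ S, f s = 0) (j : J) (q : DQuot k J S) :
    DQuot.lift f hf hS (D k j q) = D k j (DQuot.lift f hf hS q) := by
  obtain ⟨x, rfl⟩ := DQuot.mk_surjective S q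
  rw [D_mk, DQuot.lift_mk, DQuot.lift_mk, hf]

theorem Presented.eq_top_of_of_mem {S : Set (Free k J X)} (T : Subalgebra k (Presented k J S))
    (hof : ∀ x, Presented.of k J S x ∈ T) (hD : ∀ (j : J), ∀ q ∈ T, D k j q ∈ T) : T = ⊤ := by
  let π : Free k J X →ₐ[k] Presented k J S := RingCon.mkₐ k _
  have h : T.comap π = ⊤ :=
    Free.eq_top_of_of_mem (T.comap π) hof fun j u hu => hD j (DQuot.mk k J S u) hu
  rw [eq_top_iff]
  intro q _
  obtain ⟨u, rfl⟩ := DQuot.mk_surjective S q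
  have hu : u ∈ T.comap π := h ▸ Algebra.mem_top
  exact hu

theorem Presented.hom_ext {S : Set (Free k J X)} {f g : Presented k J S →ₐ[k] B}
    (hf : ∀ (j : J) q, f (D k j q) = D k j (f q)) (hg : ∀ (j : J) q, g (D k j q) = D k j (g q))
    (h : ∀ x, f (Presented.of k J S x) = g (Presented.of k J S x)) : f = g := by
  have hT := Presented.eq_top_of_of_mem (AlgHom.equalizer f g) h fun j q hq => by
    rw [AlgHom.mem_equalizer] at hq ⊢
    rw [hf, hg, hq]
  refine AlgHom.ext fun q => ?_
  have : q ∈ AlgHom.equalizer f g := hT ▸ Algebra.mem_top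
  exact this

theorem D_mem_adjoin (s : Set A) (j : J) {x : A} (hx : x ∈ adjoin k J s) :
    D k j x ∈ adjoin k J s := by
  rw [adjoin, Algebra.mem_sInf] at hx ⊢
  exact fun T hT => hT.2 j x (hx T hT)

theorem subset_adjoin (s : Set A) : s ⊆ adjoin k J s := fun x hx => by
  rw [SetLike.mem_coe, adjoin, Algebra.mem_sInf]
  exact fun T hT => hT.1 hx

end Universal

/-! ### The operator model -/

section Model

variable (k : Type*) {J : Type*} [CommRing k]

/-- The algebra of endomorphisms of a module with a family of endomorphisms `δ_j`, made into a
differential algebra by the commutators `T ↦ δ_j T - T δ_j`. -/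
noncomputable abbrev commutatorOps {M : Type*} [AddCommGroup M] [Module k M] (δ : J → Module.End k M) :
    DifferentialOps k J (Module.End k M) where
  der j := LinearMap.mulLeft k (δ j) - LinearMap.mulRight k (δ j)
  leibniz j x y := by
    simp only [LinearMap.sub_apply, LinearMap.mulLeft_apply, LinearMap.mulRight_apply]
    noncomm_ring

variable (J) (A : Type*) [Ring A] [Algebra k A] [DifferentialOps k J A]

/-- The underlying module of the free right `A`-module on `List ℕ × ℕ`. -/
abbrev ModelSpace : Type _ := List ℕ × ℕ →₀ A

/-- The differential algebra of `k`-linear operators on `ModelSpace A`, its operations being the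
commutators with the coordinatewise operations of `A`. -/
noncomputable instance modelOps : DifferentialOps k J (Module.End k (ModelSpace A)) :=
  commutatorOps k fun j => Finsupp.mapRange.linearMap (D k j)

theorem modelOps_D_apply (j : J) (T : Module.End k (ModelSpace A)) (m : ModelSpace A) :
    D k j T m = Finsupp.mapRange.linearMap (D k j) (T m) -
      T (Finsupp.mapRange.linearMap (D k j) m) :=
  rfl

/-- Left multiplication in each coordinate. -/
noncomputable def leftMul : A →ₐ[k] Module.End k (ModelSpace A) := Algebra.lsmul k k (ModelSpace A)

variable {A}

theorem leftMul_single (x c : A) (e : List ℕ × ℕ) :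
    leftMul k A x (Finsupp.single e c) = Finsupp.single e (x * c) := by
  simp [leftMul]

theorem leftMul_injective : Function.Injective (leftMul k A) := fun x y h => by
  have := congrArg (fun T => T (Finsupp.single ([], 0) 1) ([], 0)) h
  simpa [leftMul_single] using this

theorem leftMul_D (j : J) (x : A) : leftMul k A (D k j x) = D k j (leftMul k A x) := by
  refine Finsupp.lhom_ext fun e c => ?_
  have h := leibniz (k := k) j x c
  rw [modelOps_D_apply]
  simp only [leftMul_single, Finsupp.mapRange.linearMap_apply, Finsupp.mapRange_single]
  rw [← Finsupp.single_sub, D, h, add_sub_cancel_right]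

/-- The operator moving the basis vector `(l, n)` to `(l, n + 1)`. -/
noncomputable def opB : Module.End k (ModelSpace A) :=
  Finsupp.lsum k fun e => Finsupp.lsingle (e.1, e.2 + 1)

/-- The operator moving the basis vector `(l, n + 1)` to `(n :: l, 0)`, and `(p :: n :: l, 0)` to
`(l, n)` with coefficient `y (p + 1)`; on the remaining basis vectors it is irrelevant, here
zero. -/
noncomputable def opA (y : ℕ → A) : Module.End k (ModelSpace A) :=
  Finsupp.lsum k fun e => match e with
    | (l, n + 1) => Finsupp.lsingle (n :: l, 0)
    | (p :: n :: l, 0) => (Finsupp.lsingle (l, n)).comp (LinearMap.mulLeft k (y (p + 1)))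
    | _ => 0

theorem opB_pow_single (i : ℕ) (l : List ℕ) (n : ℕ) (c : A) :
    (opB k ^ i) (Finsupp.single (l, n) c) = Finsupp.single (l, n + i) c := by
  induction i with
  | zero => rfl
  | succ i ih => rw [pow_succ', Module.End.mul_apply, ih]; simp [opB, add_assoc]

theorem opA_single_succ (y : ℕ → A) (l : List ℕ) (n : ℕ) (c : A) :
    opA k y (Finsupp.single (l, n + 1) c) = Finsupp.single (n :: l, 0) c := by
  simp [opA]

theorem opA_single_cons_cons (y : ℕ → A) (l : List ℕ) (p n : ℕ) (c : A) :
    opA k y (Finsupp.single (p :: n :: l, 0) c) = Finsupp.single (l, n) (y (p + 1) * c) := by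
  simp [opA]

theorem operator_word (y : ℕ → A) {i : ℕ} (hi : 1 ≤ i) :
    opA k y * opA k y * opB k ^ i * opA k y * opB k = leftMul k A (y i) := by
  obtain ⟨p, rfl⟩ := Nat.exists_eq_add_of_le' hi
  refine Finsupp.lhom_ext fun ⟨l, n⟩ c => ?_
  have hb := opB_pow_single k 1 l n c
  rw [pow_one] at hb
  simp only [Module.End.mul_apply]
  rw [hb, opA_single_succ, opB_pow_single, zero_add, opA_single_succ, opA_single_cons_cons,
    leftMul_single]

end Model

/-! ### The two-generated extension -/

section Extension

variable (k : Type*) {J : Type*} {X : Type*} [CommRing k] (e : X → ℕ) (S : Set (Free k J X))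

/-- The canonical map from `k⟨X; D | S⟩` to its two-generated extension. -/
def extensionMap : Presented k J S →ₐ[k] Presented k J (extendedRelations k J e S) :=
  DQuot.lift ((RingCon.mkₐ k _).comp (Free.incl k J))
    (fun j u => congrArg (DQuot.mk k J (extendedRelations k J e S)) (Free.incl_D j u))
    fun s hs => DQuot.mk_eq_zero.2 (subset_ideal _ (Or.inl ⟨s, hs, rfl⟩))

theorem extensionMap_of (x : X) : extensionMap k e S (Presented.of k J S x) =
    Presented.of k J (extendedRelations k J e S) (Sum.inl x) :=
  congrArg (DQuot.mk k J (extendedRelations k J e S)) (Free.incl_of x)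

theorem extensionMap_D (j : J) (q : Presented k J S) :
    extensionMap k e S (D k j q) = D k j (extensionMap k e S q) :=
  DQuot.lift_D _ _ _ j q

/-- The extension maps to the operators over `k⟨X; D | S⟩` by the universal property, and the
composite is the injective map `leftMul`. -/
theorem extensionMap_injective (he : Function.Injective e) (hpos : ∀ x, 1 ≤ e x) :
    Function.Injective (extensionMap k e S) := by
  let y : ℕ → Presented k J S := Function.extend e (Presented.of k J S) 0
  have hy (x : X) : y (e x) = Presented.of k J S x := he.extend_apply _ _ x
  let val : X ⊕ Fin 2 → Module.End k (ModelSpace (Presented k J S)) :=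
    Sum.elim (fun x => leftMul k _ (Presented.of k J S x)) ![opA k y, opB k]
  have hincl : (Free.lift (J := J) val).comp (Free.incl k J) =
      (leftMul k (Presented k J S)).comp (RingCon.mkₐ k (ideal k J S).ringCon) := by
    refine Free.hom_ext (k := k) (J := J) (X := X)
      (B := Module.End k (ModelSpace (Presented k J S))) ?_ ?_ fun x => ?_
    · intro j u
      rw [AlgHom.comp_apply, AlgHom.comp_apply, Free.incl_D, Free.lift_D]
    · intro j u
      exact leftMul_D k J j (DQuot.mk k J S u)
    · rw [AlgHom.comp_apply, Free.incl_of, Free.lift_of]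
      rfl
  have hval : ∀ s ∈ extendedRelations k J e S, Free.lift (k := k) (J := J) val s = 0 := by
    rintro _ (⟨s, hs, rfl⟩ | ⟨x, rfl⟩)
    · have hs0 : DQuot.mk k J S s = 0 := DQuot.mk_eq_zero.2 (subset_ideal _ hs)
      refine (DFunLike.congr_fun hincl s).trans ?_
      exact (congrArg (leftMul k _) hs0).trans (map_zero _)
    · simp only [map_sub, map_mul, map_pow, Free.lift_of]
      rw [sub_eq_zero]
      exact (operator_word k y (hpos x)).trans (congrArg _ (hy x))
  let ψ : Presented k J (extendedRelations k J e S) →ₐ[k]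
      Module.End k (ModelSpace (Presented k J S)) :=
    DQuot.lift (Free.lift val) (Free.lift_D val) hval
  have hcomp : ψ.comp (extensionMap k e S) = leftMul k (Presented k J S) := by
    refine Presented.hom_ext (k := k) (J := J) (S := S)
      (B := Module.End k (ModelSpace (Presented k J S))) ?_ (leftMul_D k J) fun x => ?_
    · intro j q
      rw [AlgHom.comp_apply, AlgHom.comp_apply, extensionMap_D]
      exact DQuot.lift_D _ _ _ j _
    · rw [AlgHom.comp_apply, extensionMap_of]
      exact Free.lift_of val _
  have h : Function.Injective (ψ ∘ extensionMap k e S) := by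
    rw [← AlgHom.coe_comp, hcomp]
    exact leftMul_injective k
  exact h.of_comp

theorem adjoin_new_letters_eq_top :
    adjoin k J {Presented.of k J (extendedRelations k J e S) (Sum.inr 0),
      Presented.of k J (extendedRelations k J e S) (Sum.inr 1)} = ⊤ := by
  set T := adjoin k J {Presented.of k J (extendedRelations k J e S) (Sum.inr 0),
    Presented.of k J (extendedRelations k J e S) (Sum.inr 1)} with hT
  have ha : Presented.of k J (extendedRelations k J e S) (Sum.inr 0) ∈ T :=
    subset_adjoin _ (Or.inl rfl)
  have hb : Presented.of k J (extendedRelations k J e S) (Sum.inr 1) ∈ T :=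
    subset_adjoin _ (Or.inr rfl)
  refine Presented.eq_top_of_of_mem T ?_ fun j q hq => D_mem_adjoin _ j hq
  rintro (x | i)
  · have hrel := DQuot.mk_eq_zero.2
      (subset_ideal (k := k) (J := J) (extendedRelations k J e S) (Or.inr ⟨x, rfl⟩))
    have hword : Presented.of k J (extendedRelations k J e S) (Sum.inl x) =
        Presented.of k J (extendedRelations k J e S) (Sum.inr 0) *
        Presented.of k J (extendedRelations k J e S) (Sum.inr 0) *
        Presented.of k J (extendedRelations k J e S) (Sum.inr 1) ^ e x *
        Presented.of k J (extendedRelations k J e S) (Sum.inr 0) *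
        Presented.of k J (extendedRelations k J e S) (Sum.inr 1) :=
      (sub_eq_zero.1 hrel).symm
    rw [hword]
    exact mul_mem (mul_mem (mul_mem (mul_mem ha ha) (pow_mem hb _)) ha) hb
  · fin_cases i
    exacts [ha, hb]

end Extension

/-- Every countably generated differential algebra is presented on countably many letters. -/
theorem CountablyGenerated.exists_presentation {k J A : Type*} [CommRing k] [Ring A] [Algebra k A]
    [DifferentialOps k J A] (h : CountablyGenerated k J A) :
    ∃ (S : Set (Free k J ℕ)) (θ : A ≃ₐ[k] Presented k J S),
      ∀ (j : J) (x : A), θ (D k j x) = D k j (θ x) := by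
  obtain ⟨s, hs, hgen⟩ := h
  -- Adding `0` makes the set nonempty, hence the range of a sequence.
  obtain ⟨y, hy⟩ := (hs.insert 0).exists_eq_range (Set.insert_nonempty 0 s)
  let f : Free k J ℕ →ₐ[k] A := Free.lift y
  have hf (j : J) (u : Free k J ℕ) : f (D k j u) = D k j (f u) := Free.lift_D y j u
  have hsurj : Function.Surjective f := by
    rw [← AlgHom.range_eq_top, eq_top_iff, ← hgen]
    refine sInf_le ⟨fun x hx => ?_, ?_⟩
    · obtain ⟨n, rfl⟩ := hy ▸ Set.mem_insert_of_mem (0 : A) hx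
      exact ⟨Free.of k J n, Free.lift_of y n⟩
    · rintro j _ ⟨u, rfl⟩
      exact ⟨D k j u, hf j u⟩
  let g : Presented k J {u | f u = 0} →ₐ[k] A := DQuot.lift f hf fun _ hu => hu
  have hg : Function.Bijective g := by
    refine ⟨(injective_iff_map_eq_zero g).2 fun q hq => ?_, fun x => ?_⟩
    · obtain ⟨u, rfl⟩ := DQuot.mk_surjective _ q
      exact DQuot.mk_eq_zero.2 (subset_ideal _ hq)
    · obtain ⟨u, rfl⟩ := hsurj x
      exact ⟨DQuot.mk k J _ u, rfl⟩
  let G := AlgEquiv.ofBijective g hg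
  refine ⟨_, G.symm, fun j x => ?_⟩
  obtain ⟨q, rfl⟩ := G.surjective x
  rw [G.symm_apply_apply, G.symm_apply_eq]
  exact (DQuot.lift_D f hf (fun _ hu => hu) j q).symm

end DifferentialOps

theorem mainTheorem7 (k : Type u) [Field k] (J : Type w) :
    -- every countably generated differential algebra embeds into a two-generated one
    (∀ (A : Type v) [Ring A] [Algebra k A] [DifferentialOps k J A],
      CountablyGenerated k J A →
      ∃ (B : Type (max u w)) (_ : Ring B) (_ : Algebra k B) (_ : DifferentialOps k J B)
        (φ : A →ₐ[k] B),
        (∀ (j : J) (x : A), φ (D k j x) = D k j (φ x)) ∧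
        Function.Injective φ ∧
        ∃ a b : B, adjoin k J {a, b} = ⊤) ∧
    -- such an extension of `k⟨X; D | S⟩` is `k⟨X, a, b; D | S, a a bⁱ a b = xᵢ⟩`, where
    -- the letters of `X` are numbered by distinct positive integers
    (∀ (X : Type z) (e : X → ℕ), Function.Injective e → (∀ x, 1 ≤ e x) →
      ∀ S : Set (Free k J X),
      (∃ φ : Presented k J S →ₐ[k] Presented k J (extendedRelations k J e S),
        (∀ x : X, φ (Presented.of k J S x) =
          Presented.of k J (extendedRelations k J e S) (Sum.inl x)) ∧
        (∀ (j : J) (y : Presented k J S), φ (D k j y) = D k j (φ y)) ∧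
        Function.Injective φ) ∧
      adjoin k J {Presented.of k J (extendedRelations k J e S) (Sum.inr 0),
        Presented.of k J (extendedRelations k J e S) (Sum.inr 1)} = ⊤) := by
  constructor
  · intro A _ _ _ hA
    obtain ⟨S, θ, hθ⟩ := hA.exists_presentation
    let e : ℕ → ℕ := fun n => n + 1
    refine ⟨Presented k J (extendedRelations k J e S), inferInstance, inferInstance,
      inferInstance, (extensionMap k e S).comp θ.toAlgHom, fun j x => ?_, ?_, _, _,
      adjoin_new_letters_eq_top k e S⟩
    · exact (congrArg _ (hθ j x)).trans (extensionMap_D k e S j (θ x))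
    · exact (extensionMap_injective k e S (add_left_injective 1) fun n => Nat.le_add_left 1 n).comp
        θ.injective
  · intro X e he hpos S
    exact ⟨⟨extensionMap k e S, extensionMap_of k e S, extensionMap_D k e S,
      extensionMap_injective k e S he hpos⟩, adjoin_new_letters_eq_top k e S⟩
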